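/- Let $n,k$ be integers with $1\le k\le n-1$ and let $q>k$ be real. For $\lambda\in\mathbb R^n$ let $S_k(\lambda)=\sum_{i_1<\dots<i_k}\lambda_{i_1}\cdots\lambda_{i_k}$, and for a real symmetric $n\times n$ matrix $A$ let $S_k(A)$ be $S_k$ of its eigenvalues. Let $\Gamma_k$ be the connected component of $\{\lambda\in\mathbb R^n: S_k(\lambda)>0\}$ containing $\{\lambda:\lambda_i>0 \text{ for all } i\}$. A function $u\in C^2(\Omega)$ is called $k$-convex if for every $x\in\Omega$ the vector of eigenvalues of $D^2u(x)$ lies in $\overline{\Gamma_k}$. Write $z^+=\max\{z,0\}$. Put $w(x)=(1-|x|^2)^{\frac{k+1}{k-q}}$ for $x\in\mathbb R^n$, $|x|<1$. There is a constant $B>0$ depending only on $n,k,q$ such that $$S_k(D^2w)\le B\,w^q\quad\text{in }B_1(0).$$ For any such constant $B$ and any $a,M>0$ let $$w^{a,M}(x)=\Big(\frac{B}{a^{2k}M}\Big)^{\frac1{q-k}}\,w\Big(\frac xa\Big),\quad |x|<a,\qquad\text{and}\qquad \bar h(r)=w^{r,M}(0),\quad r>0.$$ Then $\bar h\in C^\infty((0,\infty))$,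 and the following holds. Let $\Omega\subset\mathbb R^n$ be a domain (a nonempty connected open set, not necessarily bounded), let $\psi:\Omega\times\mathbb R\times\mathbb R^n\to\mathbb R$ be a function satisfying $$\psi(x,z,p)\ge M(z^+)^q\quad\text{for all }(x,z,p)\in\Omega\times\mathbb R\times\mathbb R^n,$$ and let $u\in C^2(\Omega)$ be a $k$-convex solution of $S_k(D^2u)=\psi(x,u,Du)$ in $\Omega$. Then $$u(x)\le\bar h(d(x))\quad\text{for all }x\in\Omega,\qquad d(x)=\operatorname{dist}(x,\partial\Omega),$$ where in the case $\Omega=\mathbb R^n$, in which $d\equiv\infty$, the bound is read as $u\le \lim_{r\to\infty}\bar h(r)=0$. -/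

import Mathlib

open scoped ContDiff

noncomputable section

namespace KHessian

/-- The `k`-th elementary symmetric function `S_k(λ)` of `λ ∈ ℝⁿ`. -/
def elemSymm {n : ℕ} (k : ℕ) (l : Fin n → ℝ) : ℝ :=
  ∑ s ∈ Finset.powersetCard k (Finset.univ : Finset (Fin n)), ∏ i ∈ s, l i

/-- The eigenvalues, with multiplicity, of a real symmetric matrix
(the value `0` for non-symmetric matrices is never relevant). -/
def eigenvals {n : ℕ} (A : Matrix (Fin n) (Fin n) ℝ) : Fin n → ℝ :=
  open Classical in if h : A.IsHermitian then h.eigenvalues else 0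

/-- `S_k(A)`: the `k`-th elementary symmetric function of the eigenvalues of `A`. -/
def matSymm {n : ℕ} (k : ℕ) (A : Matrix (Fin n) (Fin n) ℝ) : ℝ :=
  elemSymm k (eigenvals A)

/-- The cone `Γ_k`: the connected component of `{S_k > 0}` containing the positive cone
`{λ | ∀ i, 0 < λ i}`. As the positive cone is connected and lies in `{S_k > 0}` (for `k ≤ n`), this
is the component of the point `(1, …, 1)`. -/
def gardingCone (n k : ℕ) : Set (Fin n → ℝ) :=
  connectedComponentIn {l : Fin n → ℝ | 0 < elemSymm k l} (fun _ => 1)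

/-- The Hessian matrix `D²u(x) = (u_{ij}(x))`. -/
def hessian {n : ℕ} (u : EuclideanSpace ℝ (Fin n) → ℝ) (x : EuclideanSpace ℝ (Fin n)) :
    Matrix (Fin n) (Fin n) ℝ :=
  Matrix.of fun i j =>
    fderiv ℝ (fderiv ℝ u) x (EuclideanSpace.single i 1) (EuclideanSpace.single j 1)

/-- `u ∈ C²(Ω)` is `k`-convex: the eigenvalues of `D²u(x)` lie in the closure of `Γ_k`
for every `x ∈ Ω`. -/
def IsKConvexOn {n : ℕ} (k : ℕ) (Ω : Set (EuclideanSpace ℝ (Fin n)))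
    (u : EuclideanSpace ℝ (Fin n) → ℝ) : Prop :=
  ContDiffOn ℝ 2 u Ω ∧ ∀ x ∈ Ω, eigenvals (hessian u x) ∈ closure (gardingCone n k)

/-- `u` solves `S_k(D²u) = ψ(x, u, Du)` in `Ω`. -/
def IsSolutionOn {n : ℕ} (k : ℕ) (Ω : Set (EuclideanSpace ℝ (Fin n)))
    (ψ : EuclideanSpace ℝ (Fin n) → ℝ → EuclideanSpace ℝ (Fin n) → ℝ)
    (u : EuclideanSpace ℝ (Fin n) → ℝ) : Prop :=
  ∀ x ∈ Ω, matSymm k (hessian u x) = ψ x (u x) (gradient u x)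

/-- The profile `w(x) = (1 - |x|²)^((k+1)/(k-q))` on the unit ball. -/
def profile (n k : ℕ) (q : ℝ) (x : EuclideanSpace ℝ (Fin n)) : ℝ :=
  (1 - ‖x‖ ^ 2) ^ (((k : ℝ) + 1) / ((k : ℝ) - q))

/-- `B > 0` is a constant for which `S_k(D²w) ≤ B w^q` in the unit ball. -/
def IsProfileConstant (n k : ℕ) (q B : ℝ) : Prop :=
  0 < B ∧ ∀ x ∈ Metric.ball (0 : EuclideanSpace ℝ (Fin n)) 1,
    matSymm k (hessian (profile n k q) x) ≤ B * profile n k q x ^ q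

/-- `w^{a,M}(x) = λ w(x/a)` with `λ = (B / (a^{2k} M))^{1/(q-k)}`, for `x` in the ball `B_a(0)`. -/
def barrier (n k : ℕ) (q B a M : ℝ) (x : EuclideanSpace ℝ (Fin n)) : ℝ :=
  (B / (a ^ (2 * k) * M)) ^ (1 / (q - (k : ℝ))) * profile n k q (a⁻¹ • x)

/-- `h̄(r) = w^{r,M}(0)`, for `r > 0`. -/
def hBar (n k : ℕ) (q B M r : ℝ) : ℝ :=
  barrier n k q B r M 0

end KHessian

end

namespace KHessian

open Polynomial

/-! ### Real-rooted polynomials -/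

/-! The barrier v satisfies S_k(D²v) ≤ M v^q in its ball and blows up at the boundary. If a closed
ball lies in Ω and u exceeds the centred barrier v at the centre, then u - v has a positive interior
maximum, where D²u ≤ D²v and u > v > 0. Monotonicity of S_k gives M u^q ≤ S_k(D²u) ≤ S_k(D²v) ≤ M
v^q < M u^q, a contradiction (`le_hBar_of_closedBall_subset`). Letting the radius grow to d(x), or
to ∞, finishes the proof.

The main work is the monotonicity `matSymm_mono`, where only the smaller matrix is known to have its
spectrum in the closed cone. Weyl's principle reduces it to vectors, where the derivative of S_k in
λ_a is S_{k-1} of the other coordinates. Its sign follows from Newton's inequalities alone: all of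
S_1, …, S_k are positive on Γ_k (`gardingCone_subset`), and removing a coordinate keeps S_1, …,
S_{k-1} positive (`symmOn_erase_pos`).

The constant B exists because D²w is a multiple of the identity plus a rank-one matrix, so S_k(D²w)
is explicit. -/

/-- By Rolle, differentiation loses at most one root counted with multiplicity, and the degree drops
as well. -/
theorem splits_derivative {p : ℝ[X]} (hp : p.Splits) : (derivative p).Splits := by
  rcases eq_or_ne p.natDegree 0 with h0 | h0
  · rw [eq_C_of_natDegree_eq_zero h0, derivative_C]
    exact Splits.zero
  · have h1 := splits_iff_card_roots.1 hp
    have h2 := card_roots_le_derivative p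
    have h3 : (derivative p).natDegree < p.natDegree := natDegree_derivative_lt h0
    have h4 := card_roots' (derivative p)
    exact splits_iff_card_roots.2 (by omega)

theorem splits_iterate_derivative {p : ℝ[X]} (hp : p.Splits) (j : ℕ) :
    (derivative^[j] p).Splits := by
  induction j with
  | zero => exact hp
  | succ j ih =>
    rw [Function.iterate_succ_apply']
    exact splits_derivative ih

/-- The difference equals the sum over i of ∏_{j ≠ i} r_j². The identity `key` is the recurrence of
this sum when a root is added. -/
theorem coeff_ineq_prod (m : Multiset ℝ) :
    0 ≤ ((m.map fun r => X - C r).prod.coeff 1) ^ 2 -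
      2 * (m.map fun r => X - C r).prod.coeff 0 * (m.map fun r => X - C r).prod.coeff 2 ∧
    ((m.map fun r => X - C r).prod.coeff 0 ≠ 0 → m ≠ 0 →
      0 < ((m.map fun r => X - C r).prod.coeff 1) ^ 2 -
      2 * (m.map fun r => X - C r).prod.coeff 0 * (m.map fun r => X - C r).prod.coeff 2) := by
  induction m using Multiset.induction_on with
  | empty => simp [coeff_one]
  | cons r m ih =>
    set g := (m.map fun r => X - C r).prod with hg
    have e0 : ((X - C r) * g).coeff 0 = -r * g.coeff 0 := by simp [sub_mul]
    have e1 : ((X - C r) * g).coeff 1 = g.coeff 0 - r * g.coeff 1 := by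
      simp [sub_mul, coeff_X_mul g 0]
    have e2 : ((X - C r) * g).coeff 2 = g.coeff 1 - r * g.coeff 2 := by
      simp [sub_mul, coeff_X_mul g 1]
    simp only [Multiset.map_cons, Multiset.prod_cons, ← hg, e0, e1, e2]
    have key : (g.coeff 0 - r * g.coeff 1) ^ 2
        - 2 * (-r * g.coeff 0) * (g.coeff 1 - r * g.coeff 2)
        = g.coeff 0 ^ 2 + r ^ 2 * (g.coeff 1 ^ 2 - 2 * g.coeff 0 * g.coeff 2) := by ring
    rw [key]
    have := ih.1
    refine ⟨by positivity, fun h _ => ?_⟩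
    have h0 : g.coeff 0 ≠ 0 := fun h' => h (by rw [h', mul_zero])
    positivity

theorem Splits.coeff_ineq {p : ℝ[X]} (hp : p.Splits) :
    2 * p.coeff 0 * p.coeff 2 ≤ p.coeff 1 ^ 2 ∧
    (p.coeff 0 ≠ 0 → p.natDegree ≠ 0 → 2 * p.coeff 0 * p.coeff 2 < p.coeff 1 ^ 2) := by
  have h := coeff_ineq_prod p.roots
  set g := (p.roots.map fun r => X - C r).prod with hg
  have e : p = C p.leadingCoeff * g := hp.eq_prod_roots
  set c := p.leadingCoeff with hc
  have e' : ∀ i, p.coeff i = c * g.coeff i := fun i => by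
    conv_lhs => rw [e]
    rw [coeff_C_mul]
  rw [e', e', e']
  have key : (c * g.coeff 1) ^ 2 - 2 * (c * g.coeff 0) * (c * g.coeff 2)
      = c ^ 2 * (g.coeff 1 ^ 2 - 2 * g.coeff 0 * g.coeff 2) := by ring
  constructor
  · rw [← sub_nonneg, key]
    exact mul_nonneg (sq_nonneg _) h.1
  · intro h0 hd
    rw [← sub_pos, key]
    have hr : p.roots ≠ 0 := by
      intro h'
      apply hd
      rw [← splits_iff_card_roots.1 hp, h', Multiset.card_zero]
    have hc0 : c ≠ 0 := fun h' => h0 (by rw [h', zero_mul])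
    have hg0 : g.coeff 0 ≠ 0 := fun h' => h0 (by rw [h', mul_zero])
    have := h.2 hg0 hr
    positivity

/-- Newton's inequality for the coefficients of a real-rooted polynomial (in its weak form). -/
theorem Splits.coeff_mul_coeff_le {p : ℝ[X]} (hp : p.Splits) (j : ℕ) :
    p.coeff j * p.coeff (j + 2) ≤ p.coeff (j + 1) ^ 2 ∧
    (p.coeff j ≠ 0 → j < p.natDegree → p.coeff j * p.coeff (j + 2) < p.coeff (j + 1) ^ 2) := by
  -- The j-th derivative moves coefficients j, j+1, j+2 to positions 0, 1, 2. After cancelling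
  -- factorials this reads (j+2) p_j p_{j+2} ≤ (j+1) p_{j+1}², which implies the claim.
  have h := Splits.coeff_ineq (splits_iterate_derivative hp j)
  simp only [coeff_iterate_derivative, nsmul_eq_mul, zero_add] at h
  rw [add_comm 1 j, add_comm 2 j, Nat.descFactorial_self] at h
  have d1 : ((j + 1).descFactorial j : ℝ) = (j + 1) * (j.factorial : ℝ) := by
    have := Nat.factorial_mul_descFactorial (Nat.le_succ j)
    simp only [Nat.succ_eq_add_one, Nat.add_sub_cancel_left, Nat.factorial_one, one_mul] at this
    rw [this, Nat.factorial_succ]; push_cast; ring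
  have d2 : 2 * ((j + 2).descFactorial j : ℝ) = (j + 2) * (j + 1) * (j.factorial : ℝ) := by
    have := Nat.factorial_mul_descFactorial (show j ≤ j + 2 by omega)
    simp only [Nat.add_sub_cancel_left, Nat.factorial_two] at this
    have : (2 : ℝ) * ((j + 2).descFactorial j : ℝ) = ((j + 2).factorial : ℝ) := by
      exact_mod_cast this
    rw [this, Nat.factorial_succ, Nat.factorial_succ]; push_cast; ring
  have f0 : 0 < (j.factorial : ℝ) := by exact_mod_cast Nat.factorial_pos j
  have hj : (0 : ℝ) ≤ j := Nat.cast_nonneg j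
  have l : 2 * ((j.factorial : ℝ) * p.coeff j) * ((j + 2).descFactorial j * p.coeff (j + 2))
      = ((j.factorial : ℝ) ^ 2 * (j + 1)) * ((j + 2) * (p.coeff j * p.coeff (j + 2))) := by
    linear_combination (j.factorial : ℝ) * p.coeff j * p.coeff (j + 2) * d2
  have r : (((j + 1).descFactorial j : ℝ) * p.coeff (j + 1)) ^ 2
      = ((j.factorial : ℝ) ^ 2 * (j + 1)) * ((j + 1) * p.coeff (j + 1) ^ 2) := by
    rw [d1]; ring
  have hpos : 0 < (j.factorial : ℝ) ^ 2 * (j + 1) := by positivity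
  rw [l, r, mul_le_mul_iff_right₀ hpos, mul_lt_mul_iff_right₀ hpos] at h
  have hsq := sq_nonneg (p.coeff (j + 1))
  constructor
  · by_contra! hlt
    nlinarith [h.1]
  · intro h0 hd
    have h2 := h.2 (mul_ne_zero f0.ne' h0) (by
      have hc : (derivative^[j] p).coeff (p.natDegree - j) ≠ 0 := by
        rw [coeff_iterate_derivative, Nat.sub_add_cancel hd.le, nsmul_eq_mul]
        have hp0 : p ≠ 0 := fun h' => h0 (by rw [h', coeff_zero])
        have : p.natDegree.descFactorial j ≠ 0 := by
          rw [Ne, Nat.descFactorial_eq_zero_iff_lt]; omega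
        exact mul_ne_zero (by exact_mod_cast this) (leadingCoeff_ne_zero.2 hp0)
      have := le_natDegree_of_ne_zero hc
      omega)
    by_contra! hlt
    nlinarith

/-! ### Elementary symmetric functions over a finset -/

section symmOn

variable {ι : Type*}

/-- The `k`-th elementary symmetric function of `l i`, `i ∈ s`. -/
def symmOn (s : Finset ι) (l : ι → ℝ) (k : ℕ) : ℝ :=
  ∑ t ∈ Finset.powersetCard k s, ∏ i ∈ t, l i

@[simp] theorem symmOn_zero (s : Finset ι) (l : ι → ℝ) : symmOn s l 0 = 1 := by
  simp [symmOn]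

theorem symmOn_eq_zero {s : Finset ι} (l : ι → ℝ) {k : ℕ} (h : s.card < k) :
    symmOn s l k = 0 := by
  simp [symmOn, Finset.powersetCard_eq_empty.2 h]

theorem symmOn_insert [DecidableEq ι] {s : Finset ι} {a : ι} (ha : a ∉ s) (l : ι → ℝ) (k : ℕ) :
    symmOn (insert a s) l (k + 1) = symmOn s l (k + 1) + l a * symmOn s l k := by
  have hmem : ∀ t ∈ Finset.powersetCard k s, a ∉ t := fun t ht h =>
    ha ((Finset.mem_powersetCard.1 ht).1 h)
  rw [symmOn, Finset.powersetCard_succ_insert ha, Finset.sum_union, Finset.sum_image]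
  · rw [symmOn, symmOn, Finset.mul_sum]
    congr 1
    exact Finset.sum_congr rfl fun t ht => Finset.prod_insert (hmem t ht)
  · intro t ht t' ht' h
    rw [← Finset.erase_insert (hmem t ht), ← Finset.erase_insert (hmem t' ht'), h]
  · rw [Finset.disjoint_left]
    rintro t ht h'
    obtain ⟨t', _, rfl⟩ := Finset.mem_image.1 h'
    exact ha ((Finset.mem_powersetCard.1 ht).1 (Finset.mem_insert_self a t'))

theorem symmOn_eq_coeff (s : Finset ι) (l : ι → ℝ) {k : ℕ} (h : k ≤ s.card) :
    symmOn s l k = (∏ i ∈ s, (X + C (l i))).coeff (s.card - k) := by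
  rw [Finset.prod_X_add_C_coeff _ _ (Nat.sub_le _ _), Nat.sub_sub_self h, symmOn]

theorem splits_prod_X_add_C (s : Finset ι) (l : ι → ℝ) : (∏ i ∈ s, (X + C (l i))).Splits :=
  Splits.prod fun _ _ => Splits.X_add_C _

theorem natDegree_prod_X_add_C' (s : Finset ι) (l : ι → ℝ) :
    (∏ i ∈ s, (X + C (l i))).natDegree = s.card := by
  rw [natDegree_prod_of_monic _ _ fun i _ => monic_X_add_C _]
  simp

theorem symmOn_newton (s : Finset ι) (l : ι → ℝ) (k : ℕ) :
    symmOn s l k * symmOn s l (k + 2) ≤ symmOn s l (k + 1) ^ 2 := by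
  rcases lt_or_ge s.card (k + 2) with h | h
  · rw [symmOn_eq_zero l h, mul_zero]
    positivity
  · rw [symmOn_eq_coeff s l h, symmOn_eq_coeff s l (show k + 1 ≤ s.card by omega),
      symmOn_eq_coeff s l (show k ≤ s.card by omega), mul_comm]
    have := (Splits.coeff_mul_coeff_le (splits_prod_X_add_C s l) (s.card - (k + 2))).1
    rwa [show s.card - (k + 2) + 2 = s.card - k by omega,
      show s.card - (k + 2) + 1 = s.card - (k + 1) by omega] at this

theorem symmOn_newton_strict (s : Finset ι) (l : ι → ℝ) (k : ℕ) (h0 : symmOn s l (k + 2) ≠ 0) :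
    symmOn s l k * symmOn s l (k + 2) < symmOn s l (k + 1) ^ 2 := by
  have h : k + 2 ≤ s.card := by
    by_contra! h
    exact h0 (symmOn_eq_zero l h)
  rw [symmOn_eq_coeff s l h] at h0 ⊢
  rw [symmOn_eq_coeff s l (show k + 1 ≤ s.card by omega),
      symmOn_eq_coeff s l (show k ≤ s.card by omega), mul_comm]
  have := (Splits.coeff_mul_coeff_le (splits_prod_X_add_C s l) (s.card - (k + 2))).2 h0
    (by rw [natDegree_prod_X_add_C']; omega)
  rwa [show s.card - (k + 2) + 2 = s.card - k by omega,
      show s.card - (k + 2) + 1 = s.card - (k + 1) by omega] at this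

/-- Downward propagation: a zero just below a positive value would make the square in the strict
Newton inequality vanish, while the product on its left is nonnegative. -/
theorem symmOn_pos_of_nonneg (s : Finset ι) (l : ι → ℝ) (k : ℕ)
    (hnn : ∀ j ≤ k, 0 ≤ symmOn s l j) (hk : 0 < symmOn s l k) :
    ∀ j ≤ k, 0 < symmOn s l j := by
  induction k with
  | zero => intro j hj; simp [Nat.le_zero.1 hj]
  | succ k ih =>
    intro j hj
    rcases hj.eq_or_lt with rfl | hj
    · exact hk
    · refine ih (fun i hi => hnn i (by omega)) ?_ j (by omega)
      rcases k with _ | k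
      · simp
      · have h1 := symmOn_newton_strict s l k hk.ne'
        have h2 := mul_nonneg (hnn k (by omega)) hk.le
        have h3 := hnn (k + 1) (by omega)
        exact lt_of_le_of_ne h3 fun h => by rw [← h] at h1; norm_num at h1; linarith

/-- If `S_1, …, S_{k+1}` are positive at `l`, then `S_1, …, S_k` are positive after removal of one
coordinate. -/
theorem symmOn_erase_pos [DecidableEq ι] {s : Finset ι} {a : ι} (ha : a ∉ s) (l : ι → ℝ) (k : ℕ)
    (hpos : ∀ j ≤ k + 1, 0 < symmOn (insert a s) l j) :
    ∀ j ≤ k, 0 < symmOn s l j := by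
  intro j
  induction j with
  | zero => intro _; simp
  | succ m ih =>
    intro hm
    have h0 := ih (by omega)
    have h1 := hpos (m + 1) (by omega)
    have h2 := hpos (m + 2) (by omega)
    rw [symmOn_insert ha] at h1 h2
    have hn := symmOn_newton s l m
    by_contra! hneg
    set x := symmOn s l m
    set y := symmOn s l (m + 1)
    set z := symmOn s l (m + 2)
    set r := l a
    -- If y ≤ 0, then x(z + ry) ≤ y² + rxy = y(y + rx) ≤ 0 by Newton, whereas x and z + ry are
    -- positive.
    nlinarith [mul_pos h0 h2, mul_nonneg (neg_nonneg.2 hneg) h1.le]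

end symmOn

/-! ### The Gårding cone -/

section cone

variable {n : ℕ}

theorem elemSymm_eq (k : ℕ) (l : Fin n → ℝ) : elemSymm k l = symmOn Finset.univ l k := rfl

theorem continuous_elemSymm (k : ℕ) : Continuous (elemSymm (n := n) k) := by
  unfold elemSymm
  fun_prop

/-- The set where `S_1, …, S_k` are all positive. -/
def positiveSet (n k : ℕ) : Set (Fin n → ℝ) := {l | ∀ j ≤ k, 0 < elemSymm j l}

theorem isOpen_positiveSet (n k : ℕ) : IsOpen (positiveSet n k) := by
  have : positiveSet n k = ⋂ j ∈ Set.Iic k, {l | 0 < elemSymm j l} := by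
    ext l; simp [positiveSet]
  rw [this]
  exact (Set.finite_Iic k).isOpen_biInter fun j _ =>
    isOpen_lt continuous_const (continuous_elemSymm j)

/-- The positive set is open, and relatively closed in {S_k > 0}: limits have S_j ≥ 0, which
`symmOn_pos_of_nonneg` upgrades to S_j > 0. It contains (1, …, 1), hence the whole component. -/
theorem gardingCone_subset (hkn : k ≤ n) : gardingCone n k ⊆ positiveSet n k := by
  have h1 : ∀ j ≤ n, 0 < elemSymm j (fun _ : Fin n => (1 : ℝ)) := by
    intro j hj
    simp only [elemSymm, Finset.prod_const_one, Finset.sum_const, Finset.card_powersetCard,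
      Finset.card_univ, Fintype.card_fin, nsmul_eq_mul, mul_one]
    exact_mod_cast Nat.choose_pos hj
  refine isPreconnected_connectedComponentIn.subset_of_closure_inter_subset
    (isOpen_positiveSet n k) ⟨fun _ => 1, mem_connectedComponentIn (h1 k hkn),
      fun j hj => h1 j (hj.trans hkn)⟩ ?_
  rintro l ⟨hl, hl'⟩
  have hk : 0 < elemSymm k l := by
    simpa using connectedComponentIn_subset _ _ hl'
  refine symmOn_pos_of_nonneg _ l k (fun j hj => ?_) hk
  have hc : IsClosed {l : Fin n → ℝ | 0 ≤ elemSymm j l} :=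
    isClosed_le continuous_const (continuous_elemSymm j)
  exact hc.closure_subset_iff.2 (fun l' hl' => (hl' j hj).le) hl

theorem symmOn_add_single (l : Fin n → ℝ) (a : Fin n) (s : ℝ) (j : ℕ) :
    elemSymm (j + 1) (l + Pi.single a s)
      = elemSymm (j + 1) l + s * symmOn (Finset.univ.erase a) l j := by
  have e : (Finset.univ : Finset (Fin n)) = insert a (Finset.univ.erase a) := by simp
  have hc : ∀ i, symmOn (Finset.univ.erase a) (l + Pi.single a s) i
      = symmOn (Finset.univ.erase a) l i := by
    intro i
    refine Finset.sum_congr rfl fun t ht => Finset.prod_congr rfl fun b hb => ?_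
    have : b ≠ a := Finset.ne_of_mem_erase ((Finset.mem_powersetCard.1 ht).1 hb)
    simp [this]
  rw [elemSymm_eq, elemSymm_eq, e, symmOn_insert (Finset.notMem_erase _ _),
    symmOn_insert (Finset.notMem_erase _ _), hc, hc]
  simp; ring

/-- S_j is affine in each coordinate, with positive slope on the positive set. Remaining in that set
allows the coordinates to be raised one after another. -/
theorem elemSymm_add_single (k : ℕ) {l : Fin n → ℝ} (hl : l ∈ positiveSet n k)
    (a : Fin n) {s : ℝ} (hs : 0 ≤ s) :
    l + Pi.single a s ∈ positiveSet n k ∧ elemSymm k l ≤ elemSymm k (l + Pi.single a s) := by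
  have main : ∀ j ≤ k, elemSymm j l ≤ elemSymm j (l + Pi.single a s) := by
    intro j hj
    rcases j with _ | j
    · simp [elemSymm]
    · rw [symmOn_add_single]
      have := symmOn_erase_pos (Finset.notMem_erase a Finset.univ) l j (fun i hi => by
        rw [Finset.insert_erase (Finset.mem_univ a)]
        exact hl i (by omega)) j le_rfl
      have := mul_nonneg hs this.le
      linarith
  exact ⟨fun j hj => (hl j hj).trans_le (main j hj), main k le_rfl⟩

theorem elemSymm_add_le (k : ℕ) {l : Fin n → ℝ} (hl : l ∈ positiveSet n k)
    {d : Fin n → ℝ} (hd : 0 ≤ d) : elemSymm k l ≤ elemSymm k (l + d) := by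
  suffices h : ∀ s : Finset (Fin n), l + ∑ i ∈ s, (Pi.single i (d i) : Fin n → ℝ) ∈ positiveSet n k ∧
      elemSymm k l ≤ elemSymm k (l + ∑ i ∈ s, Pi.single i (d i)) by
    have := (h Finset.univ).2
    rwa [Finset.univ_sum_single] at this
  intro s
  induction s using Finset.induction_on with
  | empty => simpa using hl
  | insert a s ha ih =>
    have := elemSymm_add_single k ih.1 a (hd a)
    rw [Finset.sum_insert ha, add_comm (Pi.single a (d a) : Fin n → ℝ), ← add_assoc]
    exact ⟨this.1, ih.2.trans this.2⟩

/-- With the displacement m - l frozen, the inequality is a closed condition on l, so it passes from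
the cone to its closure. Nothing is needed of m beyond l ≤ m. -/
theorem elemSymm_mono_of_mem_closure {k : ℕ} (hkn : k ≤ n) {l m : Fin n → ℝ}
    (hl : l ∈ closure (gardingCone n k)) (hlm : l ≤ m) : elemSymm k l ≤ elemSymm k m := by
  have hc : IsClosed {l' : Fin n → ℝ | elemSymm k l' ≤ elemSymm k (l' + (m - l))} :=
    isClosed_le (continuous_elemSymm k)
      ((continuous_elemSymm k).comp (continuous_id.add continuous_const))
  have := hc.closure_subset_iff.2
    (fun l' hl' => elemSymm_add_le k (gardingCone_subset hkn hl') (sub_nonneg.2 hlm)) hl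
  simpa using this

end cone

end KHessian


namespace KHessian

open Polynomial Matrix

/-! ### Monotonicity of eigenvalues -/

section eigenvalues

variable {ι : Type*} [Fintype ι] [DecidableEq ι]

theorem dotProduct_mulVec_eq_sum {A : Matrix ι ι ℝ} (hA : A.IsHermitian)
    (x : EuclideanSpace ℝ ι) :
    x.ofLp ⬝ᵥ A *ᵥ x.ofLp
      = ∑ j, hA.eigenvalues j * inner ℝ (hA.eigenvectorBasis j) x ^ 2 := by
  have h1 : x.ofLp ⬝ᵥ A *ᵥ x.ofLp = inner ℝ (WithLp.toLp 2 (A *ᵥ x.ofLp)) x := by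
    simp [EuclideanSpace.inner_eq_star_dotProduct]
  rw [h1, ← hA.eigenvectorBasis.sum_inner_mul_inner]
  refine Finset.sum_congr rfl fun j _ => ?_
  have h2 : inner ℝ (WithLp.toLp 2 (A *ᵥ x.ofLp)) (hA.eigenvectorBasis j)
      = hA.eigenvalues j * inner ℝ (hA.eigenvectorBasis j) x := by
    simp only [EuclideanSpace.inner_eq_star_dotProduct, star_trivial]
    rw [dotProduct_mulVec, ← mulVec_transpose, ← conjTranspose_eq_transpose_of_trivial, hA.eq,
      hA.mulVec_eigenvectorBasis, smul_dotProduct, smul_eq_mul, dotProduct_comm x.ofLp]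
  rw [h2]; ring

/-- Weyl's monotonicity principle. -/
theorem eigenvalues_le_of_quadratic_le {A B : Matrix ι ι ℝ} (hA : A.IsHermitian)
    (hB : B.IsHermitian) (h : ∀ x : ι → ℝ, x ⬝ᵥ A *ᵥ x ≤ x ⬝ᵥ B *ᵥ x) (i : ι) :
    hA.eigenvalues i ≤ hB.eigenvalues i := by
  -- This is the enumeration built into `eigenvalues`, which lists them in decreasing order for A
  -- and B alike.
  set e : ι ≃ Fin (Fintype.card ι) := (Fintype.equivOfCardEq (Fintype.card_fin _)).symm with he
  let L : EuclideanSpace ℝ ι →ₗ[ℝ] ({j // e i < e j} → ℝ) × ({j // e j < e i} → ℝ) :=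
    LinearMap.prod
      (LinearMap.pi fun j => (innerSL ℝ (hA.eigenvectorBasis j.1)).toLinearMap)
      (LinearMap.pi fun j => (innerSL ℝ (hB.eigenvectorBasis j.1)).toLinearMap)
  -- The conditions are indexed by j ≠ i, one fewer than the dimension, so some nonzero x satisfies
  -- them all. Its A-form sees only eigenvalues at least the i-th, its B-form only those at most the
  -- i-th.
  have hdim : Module.finrank ℝ (({j // e i < e j} → ℝ) × ({j // e j < e i} → ℝ))
      < Module.finrank ℝ (EuclideanSpace ℝ ι) := by
    rw [Module.finrank_prod, Module.finrank_fintype_fun_eq_card,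
      Module.finrank_fintype_fun_eq_card, finrank_euclideanSpace, Fintype.card_subtype,
      Fintype.card_subtype, ← Finset.card_union_of_disjoint]
    · refine (Finset.card_lt_card (t := Finset.univ) ?_).trans_eq Finset.card_univ
      rw [Finset.ssubset_univ_iff]
      intro h'
      have := h' ▸ Finset.mem_univ i
      simp at this
    · rw [Finset.disjoint_left]
      intro j hj hj'
      simp only [Finset.mem_filter] at hj hj'
      exact lt_asymm hj.2 hj'.2
  obtain ⟨x, hx, hx0⟩ := (Submodule.ne_bot_iff _).1 (LinearMap.ker_ne_bot_of_finrank_lt (f := L) hdim)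
  have hx' : L x = 0 := hx
  have hxA : ∀ j, e i < e j → inner ℝ (hA.eigenvectorBasis j) x = 0 := fun j hj =>
    congrFun (congrArg Prod.fst hx') ⟨j, hj⟩
  have hxB : ∀ j, e j < e i → inner ℝ (hB.eigenvectorBasis j) x = 0 := fun j hj =>
    congrFun (congrArg Prod.snd hx') ⟨j, hj⟩
  have hanti : ∀ {C : Matrix ι ι ℝ} (hC : C.IsHermitian) {j j' : ι}, e j ≤ e j' →
      hC.eigenvalues j' ≤ hC.eigenvalues j := fun hC _ _ h' => hC.eigenvalues₀_antitone h'
  have sA : hA.eigenvalues i * ‖x‖ ^ 2 ≤ x.ofLp ⬝ᵥ A *ᵥ x.ofLp := by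
    rw [dotProduct_mulVec_eq_sum hA, ← hA.eigenvectorBasis.sum_sq_inner_right, Finset.mul_sum]
    refine Finset.sum_le_sum fun j _ => ?_
    rcases le_or_gt (e j) (e i) with hj | hj
    · exact mul_le_mul_of_nonneg_right (hanti hA hj) (sq_nonneg _)
    · simp [hxA j hj]
  have sB : x.ofLp ⬝ᵥ B *ᵥ x.ofLp ≤ hB.eigenvalues i * ‖x‖ ^ 2 := by
    rw [dotProduct_mulVec_eq_sum hB, ← hB.eigenvectorBasis.sum_sq_inner_right, Finset.mul_sum]
    refine Finset.sum_le_sum fun j _ => ?_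
    rcases le_or_gt (e i) (e j) with hj | hj
    · exact mul_le_mul_of_nonneg_right (hanti hB hj) (sq_nonneg _)
    · simp [hxB j hj]
  have hpos : 0 < ‖x‖ ^ 2 := by
    have := norm_pos_iff.2 hx0
    positivity
  exact le_of_mul_le_mul_right ((sA.trans (h x.ofLp)).trans sB) hpos

end eigenvalues

/-! ### `S_k` of a matrix through its characteristic polynomial -/

section matSymm

variable {n : ℕ}

theorem eigenvals_eq {A : Matrix (Fin n) (Fin n) ℝ} (hA : A.IsHermitian) :
    eigenvals A = hA.eigenvalues := by
  rw [eigenvals, dif_pos hA]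

/-- `S_k` is monotone at matrices with eigenvalues in the closed Gårding cone. -/
theorem matSymm_mono {k : ℕ} (hkn : k ≤ n) {A B : Matrix (Fin n) (Fin n) ℝ}
    (hA : A.IsHermitian) (hB : B.IsHermitian) (hcone : eigenvals A ∈ closure (gardingCone n k))
    (h : ∀ x : Fin n → ℝ, x ⬝ᵥ A *ᵥ x ≤ x ⬝ᵥ B *ᵥ x) : matSymm k A ≤ matSymm k B := by
  refine elemSymm_mono_of_mem_closure hkn hcone ?_
  rw [eigenvals_eq hA, eigenvals_eq hB]
  exact fun i => eigenvalues_le_of_quadratic_le hA hB h i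

/-- S_k depends only on the multiset of eigenvalues, so l may list them in any order. -/
theorem matSymm_eq_of_charpoly {A : Matrix (Fin n) (Fin n) ℝ} (hA : A.IsHermitian) (k : ℕ)
    {l : Fin n → ℝ} (h : A.charpoly = ∏ i, (X - C (l i))) : matSymm k A = elemSymm k l := by
  have h1 := hA.roots_charpoly_eq_eigenvalues
  have h2 : A.charpoly.roots = Finset.univ.val.map l := by
    rw [h, Finset.prod, show (fun i => X - C (l i)) = (fun r => X - C r) ∘ l from rfl,
      ← Multiset.map_map, roots_multiset_prod_X_sub_C]
  rw [matSymm, eigenvals_eq hA, elemSymm, elemSymm, ← Finset.esymm_map_val,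
    ← Finset.esymm_map_val, ← h2, h1]
  rfl

theorem matSymm_smul {A : Matrix (Fin n) (Fin n) ℝ} (hA : A.IsHermitian) (k : ℕ) (c : ℝ) :
    matSymm k (c • A) = c ^ k * matSymm k A := by
  have hcA : (c • A).IsHermitian := by
    rw [IsHermitian, conjTranspose_smul, hA.eq, star_trivial]
  rw [matSymm_eq_of_charpoly hcA k (l := fun i => c * hA.eigenvalues i), matSymm,
    eigenvals_eq hA, elemSymm, elemSymm, Finset.mul_sum]
  · refine Finset.sum_congr rfl fun t ht => ?_
    rw [Finset.prod_mul_distrib, Finset.prod_const, (Finset.mem_powersetCard.1 ht).2]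
  · conv_lhs => rw [hA.spectral_theorem, Unitary.conjStarAlgAut_apply, ← Matrix.smul_mul,
      ← Matrix.mul_smul, charpoly_mul_comm, ← mul_assoc]
    simp [← diagonal_smul, charpoly_diagonal]

theorem symmOn_const {ι : Type*} (s : Finset ι) (c : ℝ) (j : ℕ) :
    symmOn s (fun _ => c) j = s.card.choose j * c ^ j := by
  rw [symmOn, Finset.sum_congr rfl (g := fun _ => c ^ j), Finset.sum_const,
    Finset.card_powersetCard, nsmul_eq_mul]
  intro t ht
  rw [Finset.prod_const, (Finset.mem_powersetCard.1 ht).2]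

/-- `S_k` of a rank-one perturbation of a multiple of the identity. -/
theorem matSymm_rank_one (hn : 0 < n) (c d : ℝ) (v : Fin n → ℝ) (j : ℕ)
    (A : Matrix (Fin n) (Fin n) ℝ) (hA : ∀ a b, A a b = (if a = b then c else 0) + d * (v a * v b)) :
    matSymm (j + 1) A = n.choose (j + 1) * c ^ (j + 1)
      + d * (v ⬝ᵥ v) * ((n - 1).choose j * c ^ j) := by
  have hAH : A.IsHermitian := by
    ext a b
    rw [conjTranspose_apply, hA, hA, star_trivial]
    simp only [eq_comm (a := a), mul_comm (v b)]
  have hAe : A = vecMulVec (d • v) v - scalar (Fin n) (-c) := by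
    ext a b
    rw [hA, Matrix.sub_apply, vecMulVec_apply, scalar_apply, diagonal_apply]
    split_ifs <;> simp <;> ring
  let z : Fin n := ⟨0, hn⟩
  rw [matSymm_eq_of_charpoly hAH (j + 1) (l := (fun _ => c) + Pi.single z (d * (v ⬝ᵥ v))),
    symmOn_add_single, elemSymm_eq, symmOn_const, symmOn_const, Finset.card_erase_of_mem
      (Finset.mem_univ z), Finset.card_univ, Fintype.card_fin]
  -- The spectrum is c with multiplicity n - 1, together with c + d|v|², placed at coordinate z.
  rw [hAe, charpoly_sub_scalar, charpoly_vecMulVec, Fintype.card_fin,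
    ← Finset.mul_prod_erase _ _ (Finset.mem_univ z),
    Finset.prod_congr rfl (g := fun _ => X - C c), Finset.prod_const,
    Finset.card_erase_of_mem (Finset.mem_univ z), Finset.card_univ, Fintype.card_fin]
  · obtain ⟨m, rfl⟩ : ∃ m, n = m + 1 := ⟨n - 1, by omega⟩
    simp [smul_eq_C_mul, pow_succ]
    ring
  · intro b hb
    simp [Finset.ne_of_mem_erase hb]

end matSymm

end KHessian


noncomputable section

namespace KHessian

open Matrix Topology Filter

/-! ### Hessians -/

section hessian

variable {n : ℕ}

theorem hessian_isHermitian {u : EuclideanSpace ℝ (Fin n) → ℝ} {x : EuclideanSpace ℝ (Fin n)}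
    (hu : ContDiffAt ℝ 2 u x) : (hessian u x).IsHermitian := by
  ext i j
  have := hu.isSymmSndFDerivAt (by simp)
  rw [conjTranspose_apply, star_trivial]
  exact this _ _

theorem dotProduct_hessian_mulVec (u : EuclideanSpace ℝ (Fin n) → ℝ)
    (y : EuclideanSpace ℝ (Fin n)) (x : Fin n → ℝ) :
    x ⬝ᵥ hessian u y *ᵥ x
      = fderiv ℝ (fderiv ℝ u) y (WithLp.toLp 2 x) (WithLp.toLp 2 x) := by
  have hx : (WithLp.toLp 2 x : EuclideanSpace ℝ (Fin n))
      = ∑ i, x i • EuclideanSpace.single i (1 : ℝ) := by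
    ext j
    simp [Pi.single_apply]
  rw [hx]
  simp only [map_sum, map_smul, _root_.sum_apply, _root_.smul_apply,
    dotProduct, mulVec, hessian, Matrix.of_apply, smul_eq_mul, Finset.mul_sum]
  rw [Finset.sum_comm]
  exact Finset.sum_congr rfl fun i _ => Finset.sum_congr rfl fun j _ => by ring

end hessian

/-- A positive second derivative would also make t a local minimum, so g would be locally constant
with second derivative zero. -/
theorem deriv_deriv_nonpos_of_isLocalMax {g : ℝ → ℝ} {t : ℝ} (hg : IsLocalMax g t)
    (hc : ContinuousAt g t) : deriv (deriv g) t ≤ 0 := by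
  by_contra! hpos
  have hmin := isLocalMin_of_deriv_deriv_pos hpos hg.deriv_eq_zero hc
  have hconst : g =ᶠ[𝓝 t] fun _ => g t := by
    filter_upwards [hg, hmin] with s h1 h2 using le_antisymm h1 h2
  have := hconst.deriv.deriv_eq
  simp at this
  linarith

theorem fderiv_fderiv_nonpos_of_isLocalMax {E : Type*} [NormedAddCommGroup E] [NormedSpace ℝ E]
    {f : E → ℝ} {y : E} (hf : ContDiffAt ℝ 2 f y) (hmax : IsLocalMax f y) (v : E) :
    fderiv ℝ (fderiv ℝ f) y v v ≤ 0 := by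
  have hline : ∀ t : ℝ, HasDerivAt (fun t : ℝ => y + t • v) v t := fun t => by
    simpa using ((hasDerivAt_id t).smul_const v).const_add y
  have hcont : Tendsto (fun t : ℝ => y + t • v) (𝓝 0) (𝓝 y) := by
    simpa using (hline 0).continuousAt.tendsto
  have hd : ∀ᶠ z in 𝓝 y, DifferentiableAt ℝ f z := by
    filter_upwards [hf.eventually (by simp)] with z hz using hz.differentiableAt (by simp)
  have h1 : deriv (fun t : ℝ => f (y + t • v)) =ᶠ[𝓝 0] fun t => fderiv ℝ f (y + t • v) v := by
    filter_upwards [hcont.eventually hd] with t ht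
    exact (ht.hasFDerivAt.comp_hasDerivAt t (hline t)).deriv
  have h2 : HasFDerivAt (fderiv ℝ f) (fderiv ℝ (fderiv ℝ f) y) (y + (0 : ℝ) • v) := by
    rw [zero_smul, add_zero]
    exact ((hf.fderiv_right (m := 1) (by norm_num)).differentiableAt (by simp)).hasFDerivAt
  have h2' : HasDerivAt (fun t : ℝ => fderiv ℝ f (y + t • v)) (fderiv ℝ (fderiv ℝ f) y v) 0 :=
    h2.comp_hasDerivAt (0 : ℝ) (hline 0)
  have h3 : deriv (deriv fun t : ℝ => f (y + t • v)) 0 = fderiv ℝ (fderiv ℝ f) y v v := by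
    rw [h1.deriv_eq]
    have h4 := h2'.clm_apply (hasDerivAt_const (0 : ℝ) v)
    rw [h4.deriv]
    simp
  rw [← h3]
  apply deriv_deriv_nonpos_of_isLocalMax
  · have : f y = f (y + (0 : ℝ) • v) := by simp
    have h4 := hcont.eventually hmax
    filter_upwards [h4] with t ht
    rwa [← this]
  · have : ContinuousAt f (y + (0 : ℝ) • v) := by simpa using hf.continuousAt
    exact ContinuousAt.comp (f := fun t : ℝ => y + t • v) this (hline 0).continuousAt

theorem fderiv_comp_smul_sub {E F : Type*} [NormedAddCommGroup E] [NormedSpace ℝ E]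
    [NormedAddCommGroup F] [NormedSpace ℝ F] (f : E → F) (c : ℝ) (x₀ x : E) :
    fderiv ℝ (fun x => f (c • (x - x₀))) x = c • fderiv ℝ f (c • (x - x₀)) := by
  rw [fderiv_comp_sub (f := fun x => f (c • x))]
  exact fderiv_comp_smul c

theorem fderiv_fderiv_comp_smul_sub {E : Type*} [NormedAddCommGroup E] [NormedSpace ℝ E]
    (g : E → ℝ) (m c : ℝ) (x₀ x : E) :
    fderiv ℝ (fderiv ℝ (fun x => m * g (c • (x - x₀)))) x
      = (m * c ^ 2) • fderiv ℝ (fderiv ℝ g) (c • (x - x₀)) := by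
  have h1 : fderiv ℝ (fun x => m * g (c • (x - x₀)))
      = (m * c) • fun x => fderiv ℝ g (c • (x - x₀)) := by
    have : (fun x => m * g (c • (x - x₀))) = m • fun x => g (c • (x - x₀)) := rfl
    rw [this]
    funext y
    rw [fderiv_const_smul_field, Pi.smul_apply, fderiv_comp_smul_sub, smul_smul, Pi.smul_apply]
  have h2 : fderiv ℝ ((m * c) • fun x => fderiv ℝ g (c • (x - x₀))) x
      = (m * c) • fderiv ℝ (fun x => fderiv ℝ g (c • (x - x₀))) x :=
    congrFun (fderiv_const_smul_field (𝕜 := ℝ) (E := E) (F := E →L[ℝ] ℝ)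
      (f := fun x => fderiv ℝ g (c • (x - x₀))) (m * c)) x
  rw [h1, h2, fderiv_comp_smul_sub, smul_smul]
  congr 1
  ring

theorem hessian_comp_smul_sub {n : ℕ} (g : EuclideanSpace ℝ (Fin n) → ℝ) (m c : ℝ)
    (x₀ x : EuclideanSpace ℝ (Fin n)) :
    hessian (fun x => m * g (c • (x - x₀))) x = (m * c ^ 2) • hessian g (c • (x - x₀)) := by
  ext i j
  simp [hessian, fderiv_fderiv_comp_smul_sub g m c x₀ x]

/-! ### The radial profile -/

section generic

theorem one_sub_norm_sq_pos {E : Type*} [SeminormedAddGroup E] {x : E} (hx : x ∈ Metric.ball (0 : E) 1) : 0 < 1 - ‖x‖ ^ 2 := by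
  rw [mem_ball_zero_iff] at hx
  nlinarith [norm_nonneg x]

variable {E : Type*} [NormedAddCommGroup E] [InnerProductSpace ℝ E]

theorem hasFDerivAt_one_sub_norm_sq_rpow (α : ℝ) {x : E} (hx : x ∈ Metric.ball (0 : E) 1) :
    HasFDerivAt (fun x : E => (1 - ‖x‖ ^ 2) ^ α)
      ((-(2 * α) * (1 - ‖x‖ ^ 2) ^ (α - 1)) • innerSL ℝ x) x := by
  have h1 : HasFDerivAt (fun x : E => 1 - ‖x‖ ^ 2) ((-2 : ℝ) • innerSL ℝ x) x := by
    refine ((hasStrictFDerivAt_norm_sq x).hasFDerivAt.const_sub 1).congr_fderiv ?_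
    rw [neg_smul, two_smul, two_smul]
  refine (h1.rpow_const (p := α) (Or.inl (one_sub_norm_sq_pos hx).ne')).congr_fderiv ?_
  rw [smul_smul]
  congr 1
  ring

theorem fderiv_fderiv_one_sub_norm_sq_rpow (α : ℝ) {x : E} (hx : x ∈ Metric.ball (0 : E) 1)
    (v w : E) :
    fderiv ℝ (fderiv ℝ fun x : E => (1 - ‖x‖ ^ 2) ^ α) x v w
      = -(2 * α) * (1 - ‖x‖ ^ 2) ^ (α - 1) * inner ℝ v w
        + 4 * α * (α - 1) * (1 - ‖x‖ ^ 2) ^ (α - 2) * (inner ℝ x v * inner ℝ x w) := by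
  have h1 : fderiv ℝ (fun x : E => (1 - ‖x‖ ^ 2) ^ α) =ᶠ[𝓝 x]
      fun y => (-(2 * α) * (1 - ‖y‖ ^ 2) ^ (α - 1)) • innerSL ℝ y := by
    filter_upwards [Metric.isOpen_ball.mem_nhds hx] with y hy
    exact (hasFDerivAt_one_sub_norm_sq_rpow α hy).fderiv
  have h2 := ((hasFDerivAt_one_sub_norm_sq_rpow (α - 1) hx).const_mul (-(2 * α))).smul
    (innerSL ℝ : E →L[ℝ] _).hasFDerivAt
  have h3 : fderiv ℝ (fun y : E => (-(2 * α) * (1 - ‖y‖ ^ 2) ^ (α - 1)) • innerSL ℝ y) x = _ :=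
    h2.fderiv
  rw [h1.fderiv_eq, h3]
  simp only [_root_.add_apply, _root_.smul_apply,
    ContinuousLinearMap.smulRight_apply, innerSL_apply_apply, smul_eq_mul]
  rw [show α - 1 - 1 = α - 2 by ring]
  have e1 : (innerSL ℝ : E →L[ℝ] _) v w = inner ℝ v w := rfl
  have e2 : (innerSL ℝ : E →L[ℝ] _) x w = inner ℝ x w := rfl
  rw [e1, e2]
  ring

end generic

section profile

variable {n : ℕ}

theorem contDiffOn_profile (k : ℕ) (q : ℝ) :
    ContDiffOn ℝ 2 (profile n k q) (Metric.ball 0 1) := by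
  refine ContDiffOn.rpow_const_of_ne ?_ fun x hx => (one_sub_norm_sq_pos hx).ne'
  exact (contDiff_const.sub (contDiff_norm_sq ℝ)).contDiffOn

theorem hessian_profile (k : ℕ) (q : ℝ) {x : EuclideanSpace ℝ (Fin n)}
    (hx : x ∈ Metric.ball (0 : EuclideanSpace ℝ (Fin n)) 1) {α : ℝ}
    (hα : α = ((k : ℝ) + 1) / ((k : ℝ) - q)) (a b : Fin n) :
    hessian (profile n k q) x a b
      = (if a = b then -(2 * α) * (1 - ‖x‖ ^ 2) ^ (α - 1) else 0)
        + 4 * α * (α - 1) * (1 - ‖x‖ ^ 2) ^ (α - 2) * (x a * x b) := by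
  have hp : profile n k q = fun x => (1 - ‖x‖ ^ 2) ^ α := by
    funext y
    rw [profile, hα]
  rw [hessian, Matrix.of_apply, hp, fderiv_fderiv_one_sub_norm_sq_rpow α hx]
  rcases eq_or_ne a b with rfl | h
  · simp [EuclideanSpace.inner_single_right]
  · simp [EuclideanSpace.inner_single_right, h]

theorem exists_isProfileConstant (k : ℕ) (hk : 1 ≤ k) (hkn : k < n) (q : ℝ) (hq : (k : ℝ) < q) :
    ∃ B : ℝ, IsProfileConstant n k q B := by
  obtain ⟨j, rfl⟩ : ∃ j, k = j + 1 := ⟨k - 1, by omega⟩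
  obtain ⟨α, hα⟩ : ∃ α : ℝ, α = (((j + 1 : ℕ) : ℝ) + 1) / (((j + 1 : ℕ) : ℝ) - q) := ⟨_, rfl⟩
  have hneg : ((j + 1 : ℕ) : ℝ) - q < 0 := by linarith
  have hα0 : α < 0 := by
    rw [hα]
    exact div_neg_of_pos_of_neg (by positivity) hneg
  -- The exponent in w is chosen for this identity: w^q then has the power of 1 - |x|² found in the
  -- rank-one term of S_k(D²w).
  have hαq : α * q = (α - 1) * ((j + 1 : ℕ) : ℝ) - 1 := by
    have : α * (((j + 1 : ℕ) : ℝ) - q) = ((j + 1 : ℕ) : ℝ) + 1 := by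
      rw [hα, div_mul_cancel₀ _ hneg.ne]
    linarith
  have hp : 0 < -(2 * α) := by linarith
  have hp' : 0 < 4 * α * (α - 1) := by nlinarith
  have hch : 0 < (n.choose (j + 1) : ℝ) := by exact_mod_cast Nat.choose_pos hkn.le
  refine ⟨n.choose (j + 1) * (-(2 * α)) ^ (j + 1)
    + 4 * α * (α - 1) * ((n - 1).choose j * (-(2 * α)) ^ j), by positivity, fun x hx => ?_⟩
  have hz := one_sub_norm_sq_pos hx
  rw [matSymm_rank_one (by omega) _ _ (fun i => x i) j _ (hessian_profile (j + 1) q hx hα)]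
  have hxx : (fun i => x i) ⬝ᵥ (fun i => x i) = ‖x‖ ^ 2 := by
    rw [EuclideanSpace.norm_sq_eq, dotProduct]
    simp [sq]
  rw [hxx, profile, ← hα, ← Real.rpow_mul hz.le, hαq]
  set z := 1 - ‖x‖ ^ 2 with hzdef
  have hz1 : z ≤ 1 := by nlinarith [norm_nonneg x]
  have hx1 : ‖x‖ ^ 2 ≤ 1 := by linarith
  set W := z ^ ((α - 1) * ((j + 1 : ℕ) : ℝ) - 1) with hW
  -- The identity term is less singular by one power of z, and z ≤ 1.
  have e1 : (z ^ (α - 1)) ^ (j + 1) ≤ W := by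
    rw [← Real.rpow_mul_natCast hz.le]
    exact Real.rpow_le_rpow_of_exponent_ge hz hz1 (by linarith)
  have e2 : z ^ (α - 2) * (z ^ (α - 1)) ^ j = W := by
    rw [← Real.rpow_mul_natCast hz.le, ← Real.rpow_add hz, hW]
    congr 1
    push_cast
    ring
  have hW0 : 0 < W := Real.rpow_pos_of_pos hz _
  rw [mul_pow, mul_pow, add_mul]
  refine add_le_add ?_ ?_
  · rw [← mul_assoc]
    exact mul_le_mul_of_nonneg_left e1 (by positivity)
  · have : 4 * α * (α - 1) * z ^ (α - 2) * ‖x‖ ^ 2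
        * (((n - 1).choose j : ℝ) * ((-(2 * α)) ^ j * (z ^ (α - 1)) ^ j))
        = ‖x‖ ^ 2 * (4 * α * (α - 1) * (((n - 1).choose j : ℝ) * (-(2 * α)) ^ j) * W) := by
      rw [← e2]; ring
    rw [this]
    exact mul_le_of_le_one_left (by positivity) hx1

end profile

end KHessian

end


noncomputable section

namespace KHessian

open Matrix Topology Filter

/-! ### Comparison with the barrier -/

theorem hBar_eq (n k : ℕ) (q B M r : ℝ) :
    hBar n k q B M r = (B / (r ^ (2 * k) * M)) ^ (1 / (q - (k : ℝ))) := by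
  simp [hBar, barrier, profile]

theorem contDiffOn_hBar (n k : ℕ) {q B M : ℝ} (hB : 0 < B) (hM : 0 < M) :
    ContDiffOn ℝ ∞ (hBar n k q B M) (Set.Ioi 0) := by
  have : hBar n k q B M = fun r => (B / (r ^ (2 * k) * M)) ^ (1 / (q - (k : ℝ))) :=
    funext fun r => hBar_eq n k q B M r
  rw [this]
  have hpos : ∀ r ∈ Set.Ioi (0 : ℝ), 0 < r ^ (2 * k) * M := fun r hr =>
    mul_pos (pow_pos hr _) hM
  refine ContDiffOn.rpow_const_of_ne (ContDiffOn.div contDiffOn_const ?_ fun r hr =>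
    (hpos r hr).ne') fun r hr => (div_pos hB (hpos r hr)).ne'
  fun_prop

theorem tendsto_hBar_atTop (n : ℕ) {k : ℕ} (hk : 1 ≤ k) {q B M : ℝ} (hq : (k : ℝ) < q)
    (hM : 0 < M) : Tendsto (hBar n k q B M) atTop (𝓝 0) := by
  have : hBar n k q B M = fun r => (B / (r ^ (2 * k) * M)) ^ (1 / (q - (k : ℝ))) :=
    funext fun r => hBar_eq n k q B M r
  rw [this]
  have hpos : 0 < 1 / (q - (k : ℝ)) := one_div_pos.2 (sub_pos.2 hq)
  have h1 : Tendsto (fun r : ℝ => B / (r ^ (2 * k) * M)) atTop (𝓝 0) :=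
    tendsto_const_nhds.div_atTop
      ((tendsto_pow_atTop (by omega)).atTop_mul_const hM)
  have h2 := h1.rpow_const (p := 1 / (q - (k : ℝ))) (Or.inr hpos.le)
  rwa [Real.zero_rpow hpos.ne'] at h2

theorem exists_one_sub_sq_rpow_gt {α : ℝ} (hα : α < 0) (C : ℝ) :
    ∃ ρ : ℝ, 0 < ρ ∧ ρ < 1 ∧ C < (1 - ρ ^ 2) ^ α := by
  have h := (tendsto_rpow_atTop (neg_pos.2 hα)).eventually_gt_atTop C
  obtain ⟨N, hN, hN2⟩ := (h.and (eventually_ge_atTop (2 : ℝ))).exists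
  have hN0 : 0 < N := by linarith
  have hinv : N⁻¹ ≤ 1 / 2 := by rw [← one_div]; exact one_div_le_one_div_of_le (by norm_num) hN2
  have hinv0 : 0 < N⁻¹ := inv_pos.2 hN0
  refine ⟨Real.sqrt (1 - N⁻¹), Real.sqrt_pos.2 (by linarith), ?_, ?_⟩
  · rw [Real.sqrt_lt' one_pos]; linarith
  · rw [Real.sq_sqrt (by linarith), sub_sub_cancel, Real.inv_rpow hN0.le, ← Real.rpow_neg hN0.le]
    exact hN

/-- The barrier, centred at `x₀`, is a supersolution. -/
theorem matSymm_hessian_barrier_le {n k : ℕ} {q B : ℝ} (hq : (k : ℝ) < q)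
    (hB : IsProfileConstant n k q B) {a M : ℝ} (ha : 0 < a) (hM : 0 < M)
    {x₀ y : EuclideanSpace ℝ (Fin n)} (hy : y ∈ Metric.ball x₀ a) :
    ContDiffAt ℝ 2 (fun x => barrier n k q B a M (x - x₀)) y ∧
    0 < barrier n k q B a M (y - x₀) ∧
    matSymm k (hessian (fun x => barrier n k q B a M (x - x₀)) y)
      ≤ M * barrier n k q B a M (y - x₀) ^ q := by
  have hmem : a⁻¹ • (y - x₀) ∈ Metric.ball (0 : EuclideanSpace ℝ (Fin n)) 1 := by
    rw [mem_ball_zero_iff, norm_smul, Real.norm_of_nonneg (inv_nonneg.2 ha.le),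
      ← dist_eq_norm, inv_mul_lt_one₀ ha]
    exact hy
  have hprofile : ContDiffAt ℝ 2 (profile n k q) (a⁻¹ • (y - x₀)) :=
    (contDiffOn_profile k q).contDiffAt (Metric.isOpen_ball.mem_nhds hmem)
  have hg : 0 < profile n k q (a⁻¹ • (y - x₀)) :=
    Real.rpow_pos_of_pos (one_sub_norm_sq_pos hmem) _
  have hX : 0 < B / (a ^ (2 * k) * M) := div_pos hB.1 (by positivity)
  have hbar : (fun x => barrier n k q B a M (x - x₀)) = fun x =>
    (B / (a ^ (2 * k) * M)) ^ (1 / (q - (k : ℝ))) * profile n k q (a⁻¹ • (x - x₀)) := rfl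
  have hbary : barrier n k q B a M (y - x₀) =
    (B / (a ^ (2 * k) * M)) ^ (1 / (q - (k : ℝ))) * profile n k q (a⁻¹ • (y - x₀)) := rfl
  rw [hbar, hbary]
  set m := (B / (a ^ (2 * k) * M)) ^ (1 / (q - (k : ℝ))) with hm
  have hm0 : 0 < m := Real.rpow_pos_of_pos hX _
  refine ⟨?_, mul_pos hm0 hg, ?_⟩
  · refine contDiffAt_const.mul (ContDiffAt.comp (f := fun x => a⁻¹ • (x - x₀)) y hprofile ?_)
    fun_prop
  · rw [hessian_comp_smul_sub, matSymm_smul (hessian_isHermitian hprofile)]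
    -- The amplitude m solves (m a⁻²)^k B = M m^q, which turns the profile's constant B into M.
    have hmq : m ^ q = m ^ k * (B / (a ^ (2 * k) * M)) := by
      have h1 : m ^ (q - (k : ℝ)) = B / (a ^ (2 * k) * M) := by
        rw [hm, ← Real.rpow_mul hX.le, one_div_mul_cancel (sub_pos.2 hq).ne', Real.rpow_one]
      rw [← h1, ← Real.rpow_natCast, ← Real.rpow_add hm0]
      congr 1
      ring
    rw [Real.mul_rpow hm0.le hg.le, hmq]
    calc (m * a⁻¹ ^ 2) ^ k * matSymm k (hessian (profile n k q) (a⁻¹ • (y - x₀)))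
        ≤ (m * a⁻¹ ^ 2) ^ k * (B * profile n k q (a⁻¹ • (y - x₀)) ^ q) :=
          mul_le_mul_of_nonneg_left (hB.2 _ hmem) (by positivity)
      _ = _ := by
          rw [mul_pow, ← pow_mul, inv_pow]
          field_simp

theorem fderiv_fderiv_sub {E : Type*} [NormedAddCommGroup E] [NormedSpace ℝ E] {f g : E → ℝ}
    {y : E} (hf : ContDiffAt ℝ 2 f y) (hg : ContDiffAt ℝ 2 g y) (v w : E) :
    fderiv ℝ (fderiv ℝ fun x => f x - g x) y v w
      = fderiv ℝ (fderiv ℝ f) y v w - fderiv ℝ (fderiv ℝ g) y v w := by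
  have h1 : fderiv ℝ (fun x => f x - g x) =ᶠ[𝓝 y] fun x => fderiv ℝ f x - fderiv ℝ g x := by
    filter_upwards [hf.eventually (by simp), hg.eventually (by simp)] with z hz hz'
    exact fderiv_fun_sub (hz.differentiableAt (by simp)) (hz'.differentiableAt (by simp))
  have hf' : DifferentiableAt ℝ (fderiv ℝ f) y :=
    (hf.fderiv_right (m := 1) (by norm_num)).differentiableAt (by simp)
  have hg' : DifferentiableAt ℝ (fderiv ℝ g) y :=
    (hg.fderiv_right (m := 1) (by norm_num)).differentiableAt (by simp)
  rw [h1.fderiv_eq, fderiv_fun_sub hf' hg']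
  rfl

theorem le_hBar_of_closedBall_subset {n k : ℕ} (hkn : k < n) {q B M a : ℝ}
    (hq : (k : ℝ) < q) (hB : IsProfileConstant n k q B) (hM : 0 < M) (ha : 0 < a)
    {Ω : Set (EuclideanSpace ℝ (Fin n))} (hΩ : IsOpen Ω) {u : EuclideanSpace ℝ (Fin n) → ℝ}
    (hu : IsKConvexOn k Ω u)
    (hsub : ∀ x ∈ Ω, M * (max (u x) 0) ^ q ≤ matSymm k (hessian u x))
    {x₀ : EuclideanSpace ℝ (Fin n)} (hball : Metric.closedBall x₀ a ⊆ Ω) :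
    u x₀ ≤ hBar n k q B M a := by
  by_contra! hlt
  set v : EuclideanSpace ℝ (Fin n) → ℝ := fun x => barrier n k q B a M (x - x₀) with hv
  have hv0 : v x₀ = hBar n k q B M a := by simp [hv, hBar]
  have hsup := fun y (hy : y ∈ Metric.ball x₀ a) => matSymm_hessian_barrier_le hq hB ha hM hy
  have huc : ContinuousOn u (Metric.closedBall x₀ a) := hu.1.continuousOn.mono hball
  obtain ⟨b, -, hb⟩ := (isCompact_closedBall x₀ a).exists_isMaxOn
    ⟨x₀, Metric.mem_closedBall_self ha.le⟩ huc
  have hα : ((k : ℝ) + 1) / ((k : ℝ) - q) < 0 :=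
    div_neg_of_pos_of_neg (by positivity) (by linarith)
  have hm0 : 0 < (B / (a ^ (2 * k) * M)) ^ (1 / (q - (k : ℝ))) :=
    Real.rpow_pos_of_pos (div_pos hB.1 (by positivity)) _
  -- On the sphere of radius aρ the barrier exceeds max u over the closed ball, so the maximum of u
  -- - v on the smaller ball is interior and v stays finite there.
  obtain ⟨ρ, hρ0, hρ1, hρ⟩ := exists_one_sub_sq_rpow_gt hα
    (u b / (B / (a ^ (2 * k) * M)) ^ (1 / (q - (k : ℝ))))
  rw [div_lt_iff₀' hm0] at hρ
  have hsphere : ∀ y, dist y x₀ = a * ρ → u b < v y := by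
    intro y hy
    have : ‖a⁻¹ • (y - x₀)‖ = ρ := by
      rw [norm_smul, Real.norm_of_nonneg (inv_nonneg.2 ha.le), ← dist_eq_norm, hy,
        inv_mul_cancel_left₀ ha.ne']
    simpa only [hv, barrier, profile, this] using hρ
  have haρ : a * ρ < a := mul_lt_of_lt_one_right ha hρ1
  have hsub' : Metric.closedBall x₀ (a * ρ) ⊆ Metric.ball x₀ a :=
    Metric.closedBall_subset_ball haρ
  have hvc : ContinuousOn v (Metric.closedBall x₀ (a * ρ)) := fun y hy =>
    (hsup y (hsub' hy)).1.continuousAt.continuousWithinAt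
  obtain ⟨y, hy, hymax⟩ := (isCompact_closedBall x₀ (a * ρ)).exists_isMaxOn
    ⟨x₀, Metric.mem_closedBall_self (by positivity)⟩
    ((huc.mono (hsub'.trans Metric.ball_subset_closedBall)).sub hvc)
  have hx₀y : u x₀ - v x₀ ≤ u y - v y :=
    hymax (Metric.mem_closedBall_self (by positivity))
  have hpos : v y < u y := by linarith
  have hya : y ∈ Metric.ball x₀ a := hsub' hy
  have hyint : y ∈ Metric.ball x₀ (a * ρ) := by
    refine lt_of_le_of_ne (Metric.mem_closedBall.1 hy) fun h => ?_
    have h1 := hsphere y h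
    have h2 : u y ≤ u b := hb (Metric.ball_subset_closedBall hya)
    linarith
  have hyΩ : y ∈ Ω := hball (Metric.ball_subset_closedBall hya)
  have hloc : IsLocalMax (fun x => u x - v x) y := by
    filter_upwards [Metric.isOpen_ball.mem_nhds hyint] with z hz using
      hymax (Metric.ball_subset_closedBall hz)
  have huy : ContDiffAt ℝ 2 u y := hu.1.contDiffAt (hΩ.mem_nhds hyΩ)
  obtain ⟨hvy, hvpos, hvle⟩ := hsup y hya
  have hquad : ∀ x : Fin n → ℝ, x ⬝ᵥ hessian u y *ᵥ x ≤ x ⬝ᵥ hessian v y *ᵥ x := by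
    intro x
    have h1 := fderiv_fderiv_nonpos_of_isLocalMax (huy.sub hvy) hloc (WithLp.toLp 2 x)
    rw [fderiv_fderiv_sub huy hvy] at h1
    rw [dotProduct_hessian_mulVec, dotProduct_hessian_mulVec]
    exact sub_nonpos.1 h1
  have h1 := matSymm_mono hkn.le (hessian_isHermitian huy) (hessian_isHermitian hvy)
    (hu.2 y hyΩ) hquad
  have h2 := hsub y hyΩ
  have hq0 : 0 < q := lt_of_le_of_lt (Nat.cast_nonneg k) hq
  have hvpos' : 0 < v y := hvpos
  rw [max_eq_left (hvpos'.trans hpos).le] at h2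
  have h3 : v y ^ q < u y ^ q := Real.rpow_lt_rpow hvpos'.le hpos hq0
  have h4 : M * v y ^ q < M * u y ^ q := mul_lt_mul_of_pos_left h3 hM
  exact absurd ((h2.trans h1).trans hvle) (not_le.2 h4)

/-- The ball is connected, meets Ω and misses its frontier, so it cannot leave Ω. -/
theorem ball_infDist_frontier_subset {E : Type*} [NormedAddCommGroup E] [NormedSpace ℝ E]
    {Ω : Set E} (hΩ : IsOpen Ω) {x : E} (hx : x ∈ Ω) :
    Metric.ball x (Metric.infDist x (frontier Ω)) ⊆ Ω := by
  rcases Metric.ball x (Metric.infDist x (frontier Ω)) |>.eq_empty_or_nonempty with he | hne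
  · rw [he]; exact Set.empty_subset _
  refine (convex_ball x _).isPreconnected.subset_of_closure_inter_subset hΩ
    ⟨x, Metric.mem_ball_self (Metric.nonempty_ball.1 hne), hx⟩ ?_
  rintro y ⟨hy, hyb⟩
  by_contra hyΩ
  have hyf : y ∈ frontier Ω := by
    rw [hΩ.frontier_eq]
    exact ⟨hy, hyΩ⟩
  have := Metric.infDist_le_dist_of_mem (x := x) hyf
  rw [Metric.mem_ball, dist_comm] at hyb
  linarith

end KHessian

end

theorem corollary3p6 (n k : ℕ) (hk : 1 ≤ k) (hkn : k < n) (q : ℝ) (hq : (k : ℝ) < q) :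
    (∃ B : ℝ, KHessian.IsProfileConstant n k q B) ∧
    ∀ B : ℝ, KHessian.IsProfileConstant n k q B →
    ∀ M : ℝ, 0 < M →
      ContDiffOn ℝ ∞ (KHessian.hBar n k q B M) (Set.Ioi 0) ∧
      ∀ Ω : Set (EuclideanSpace ℝ (Fin n)), IsOpen Ω → IsConnected Ω →
      ∀ ψ : EuclideanSpace ℝ (Fin n) → ℝ → EuclideanSpace ℝ (Fin n) → ℝ,
        (∀ x ∈ Ω, ∀ (z : ℝ) (p : EuclideanSpace ℝ (Fin n)), M * (max z 0) ^ q ≤ ψ x z p) →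
      ∀ u : EuclideanSpace ℝ (Fin n) → ℝ,
        KHessian.IsKConvexOn k Ω u → KHessian.IsSolutionOn k Ω ψ u →
        (Ω ≠ Set.univ →
          ∀ x ∈ Ω, u x ≤ KHessian.hBar n k q B M (Metric.infDist x (frontier Ω))) ∧
        -- For `Ω = ℝⁿ` one has `d = ∞`, and the bound is `u ≤ 0`, the limit of `h̄` at infinity.
        (Ω = Set.univ → ∀ x, u x ≤ 0) := by
  refine ⟨KHessian.exists_isProfileConstant k hk hkn q hq, fun B hB M hM =>
    ⟨KHessian.contDiffOn_hBar n k hB.1 hM, fun Ω hΩ hΩc ψ hψ u hu hsol => ?_⟩⟩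
  have hsub : ∀ x ∈ Ω, M * (max (u x) 0) ^ q ≤ KHessian.matSymm k (KHessian.hessian u x) :=
    fun x hx => (hψ x hx _ _).trans_eq (hsol x hx).symm
  have main : ∀ x a, 0 < a → Metric.closedBall x a ⊆ Ω → u x ≤ KHessian.hBar n k q B M a :=
    fun x a ha hball =>
      KHessian.le_hBar_of_closedBall_subset hkn hq hB hM ha hΩ hu hsub hball
  constructor
  · intro hne x hx
    have hfne : (frontier Ω).Nonempty := nonempty_frontier_iff.2 ⟨hΩc.nonempty, hne⟩
    have hd : 0 < Metric.infDist x (frontier Ω) := by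
      rw [← isClosed_frontier.notMem_iff_infDist_pos hfne, hΩ.frontier_eq]
      exact fun h => h.2 hx
    have hcont := (KHessian.contDiffOn_hBar n k (q := q) hB.1 hM).continuousOn.continuousAt
      (Ioi_mem_nhds hd)
    -- The comparison needs a closed ball inside Ω, so it is applied with a < d(x), and continuity
    -- of `hBar` gives the limit a → d(x).
    refine ge_of_tendsto (hcont.tendsto.mono_left
      (nhdsWithin_le_nhds (s := Set.Iio (Metric.infDist x (frontier Ω))))) ?_
    filter_upwards [Ioo_mem_nhdsLT hd] with a ha
    exact main x a ha.1 ((Metric.closedBall_subset_ball ha.2).trans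
      (KHessian.ball_infDist_frontier_subset hΩ hx))
  · rintro rfl x
    refine ge_of_tendsto (KHessian.tendsto_hBar_atTop n (B := B) hk hq hM) ?_
    filter_upwards [Filter.eventually_gt_atTop 0] with a ha
    exact main x a ha (Set.subset_univ _)
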